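/- Let $L, N_{st}, N_p \ge 1$, $N = N_{st}N_p$, and let $\mathbf R_{st}\in\mathbb C^{N_{st}\times N_{st}}$, $\mathbf R_p\in\mathbb C^{N_p\times N_p}$ be Hermitian positive definite. Let $\mathbf y_1,\dots,\mathbf y_L$ be independent, identically distributed random vectors in $\mathbb C^N$ with a complex elliptically symmetric distribution with scatter matrix $\mathbf R=\mathbf R_{st}\otimes\mathbf R_p$, that is, with density $C_{N,g}\det(\mathbf R)^{-1} g(\mathbf y^{\mathrm H}\mathbf R^{-1}\mathbf y)$ with respect to Lebesgue measure, where $g\ge 0$ is a measurable density generator and $C_{N,g}>0$ a normalizing constant. Let $\mathbf Y_l\in\mathbb C^{N_p\times N_{st}}$ be the matrix whose $i$-th column is the $i$-th block of length $N_p$ of $\mathbf y_l$, and put $$\mathbf C_{st}=\frac{N}{LN_p}\sum_{l=1}^L\frac{\left(\mathbf Y_l^{\mathrm H}\mathbf R_p^{-1}\mathbf Y_l\right)^{\mathrm T}}{\mathbf y_l^{\mathrm H}(\mathbf R_{st}\otimes\mathbf R_p)^{-1}\mathbf y_l},\qquad \mathbf C_{p}=\frac{N}{LN_{st}}\sum_{l=1}^L\frac{\mathbf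 Y_l\left(\mathbf R_{st}^{-1}\right)^{\mathrm T}\mathbf Y_l^{\mathrm H}}{\mathbf y_l^{\mathrm H}(\mathbf R_{st}\otimes\mathbf R_p)^{-1}\mathbf y_l}.$$ With $\|\cdot\|$ the Frobenius norm, the errors $\mathbb E\|(1-\rho)\mathbf C_{st}+\rho\mathbf I-\mathbf R_{st}\|^2$ and $\mathbb E\|(1-\rho)\mathbf C_{p}+\rho\mathbf I-\mathbf R_{p}\|^2$ are finite for all $\rho\in\mathbb R$. Unless $N_{st}=1$ and $\mathbf R_{st}=1$, the first error has exactly one minimizer over $\rho\in\mathbb R$, namely $$\rho_{st}^\star=\frac{\mathrm{Tr}^2(\mathbf R_{st})-\frac1{N_{st}}\mathrm{Tr}(\mathbf R_{st}^2)}{\left(\mathrm{Tr}^2(\mathbf R_{st})+\left(1-\frac{2\mathrm{Tr}(\mathbf R_{st})}{N_{st}}\right)(LN+L)\right)+\left(N_pL+\frac{L-1}{N_{st}}\right)\mathrm{Tr}(\mathbf R_{st}^2)},$$ and unless $N_p=1$ and $\mathbf R_p=1$, the second error has exactly one minimizer over $\rho\in\mathbb R$, namely $$\rho_{p}^\star=\frac{\mathrm{Tr}^2(\mathbf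 R_{p})-\frac1{N_{p}}\mathrm{Tr}(\mathbf R_{p}^2)}{\left(\mathrm{Tr}^2(\mathbf R_{p})+\left(1-\frac{2\mathrm{Tr}(\mathbf R_{p})}{N_{p}}\right)(LN+L)\right)+\left(N_{st}L+\frac{L-1}{N_{p}}\right)\mathrm{Tr}(\mathbf R_{p}^2)};$$ in both cases the denominator is nonzero. -/

import Mathlib

open MeasureTheory ProbabilityTheory
open scoped Matrix Kronecker ComplexOrder

noncomputable section

namespace KroneckerShrinkage

/-- The Hermitian form `vᴴ R⁻¹ v` (a real number when `R` is Hermitian). -/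
def quadForm {n : Type*} [Fintype n] [DecidableEq n] (R : Matrix n n ℂ) (v : n → ℂ) : ℝ :=
  (star v ⬝ᵥ (R⁻¹ *ᵥ v)).re

/-- The complex elliptically symmetric law with scatter matrix `R`, density generator `g` and
normalizing constant `c`: its density with respect to Lebesgue measure on `ℂⁿ` is
`c · det(R)⁻¹ · g(vᴴ R⁻¹ v)`. -/
def cesLaw {n : Type*} [Fintype n] [DecidableEq n] (R : Matrix n n ℂ) (c : ℝ) (g : ℝ → ℝ) :
    Measure (n → ℂ) :=
  (volume : Measure (n → ℂ)).withDensity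
    fun v => ENNReal.ofReal (c * (R.det.re)⁻¹ * g (quadForm R v))

/-- Reshape a vector of length `N = Nst * Np` into an `Np × Nst` matrix, column by column.
The `i`-th block of length `Np` of the vector, that is `j ↦ y (i, j)`, is the `i`-th column.
This is the ordering of the entries for which the Kronecker product of an `Nst × Nst` and an
`Np × Np` matrix is indexed by pairs `(i, j)`. -/
def unvec {Nst Np : ℕ} (y : Fin Nst × Fin Np → ℂ) : Matrix (Fin Np) (Fin Nst) ℂ :=
  Matrix.of fun j i => y (i, j)

/-- The statistic `C_st = N / (L Np) ∑ₗ (Yₗᴴ Rp⁻¹ Yₗ)ᵀ / (yₗᴴ (Rst ⊗ Rp)⁻¹ yₗ)`.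
The transpose matches the column-by-column reshaping: if `y` has covariance `Rst ⊗ Rp`, then
`E (Yᴴ Rp⁻¹ Y)` is a multiple of `Rstᵀ`. For `Np = 1` and `Rp = 1` the summand is
`y yᴴ / (yᴴ Rst⁻¹ y)`. -/
def Cst {L Nst Np : ℕ} (Rst : Matrix (Fin Nst) (Fin Nst) ℂ) (Rp : Matrix (Fin Np) (Fin Np) ℂ)
    (y : Fin L → Fin Nst × Fin Np → ℂ) : Matrix (Fin Nst) (Fin Nst) ℂ :=
  (((Nst * Np : ℕ) : ℝ) / ((L : ℝ) * (Np : ℝ))) •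
    ∑ l, (quadForm (Rst ⊗ₖ Rp) (y l))⁻¹ • ((unvec (y l))ᴴ * Rp⁻¹ * unvec (y l))ᵀ

/-- The statistic `C_p = N / (L Nst) ∑ₗ (Yₗ (Rst⁻¹)ᵀ Yₗᴴ) / (yₗᴴ (Rst ⊗ Rp)⁻¹ yₗ)`.
The transpose matches the column-by-column reshaping:
`yᴴ (Rst ⊗ Rp)⁻¹ y = Tr (Rp⁻¹ Y (Rst⁻¹)ᵀ Yᴴ)`. -/
def Cp {L Nst Np : ℕ} (Rst : Matrix (Fin Nst) (Fin Nst) ℂ) (Rp : Matrix (Fin Np) (Fin Np) ℂ)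
    (y : Fin L → Fin Nst × Fin Np → ℂ) : Matrix (Fin Np) (Fin Np) ℂ :=
  (((Nst * Np : ℕ) : ℝ) / ((L : ℝ) * (Nst : ℝ))) •
    ∑ l, (quadForm (Rst ⊗ₖ Rp) (y l))⁻¹ • (unvec (y l) * (Rst⁻¹)ᵀ * (unvec (y l))ᴴ)

section Frobenius

open scoped Matrix.Norms.Frobenius

/-- Squared Frobenius error of the linear shrinkage estimate `(1 - ρ) C + ρ I` of `R`. -/
def sqError {n : ℕ} (R C : Matrix (Fin n) (Fin n) ℂ) (ρ : ℝ) : ℝ :=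
  ‖((1 - ρ) • C + ρ • (1 : Matrix (Fin n) (Fin n) ℂ)) - R‖ ^ 2

end Frobenius

/-- The numerator `Tr²(R) - Tr(R²) / n`. -/
def koasNum {n : ℕ} (R : Matrix (Fin n) (Fin n) ℂ) : ℝ :=
  R.trace.re ^ 2 - 1 / (n : ℝ) * (R ^ 2).trace.re

/-- The denominator
`(Tr²(R) + (1 - 2 Tr(R) / n) (L N + L)) + (m L + (L - 1) / n) Tr(R²)`, where `N = n m` and `m` is
the dimension of the other Kronecker factor. -/
def koasDen {n : ℕ} (L m : ℕ) (R : Matrix (Fin n) (Fin n) ℂ) : ℝ :=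
  (R.trace.re ^ 2 +
      (1 - 2 * R.trace.re / (n : ℝ)) * ((L : ℝ) * ((n * m : ℕ) : ℝ) + (L : ℝ))) +
    ((m : ℝ) * (L : ℝ) + ((L : ℝ) - 1) / (n : ℝ)) * (R ^ 2).trace.re

end KroneckerShrinkage

end

/-! Write `Rst = B Bᴴ`, `Rp = A Aᴴ` and `M = B ⊗ A`, so that the scatter matrix is `M Mᴴ`. The
whitened vector `x = M⁻¹ y` has a law invariant under every linear isometry of `ℂᴺ`
(`unitarilyInvariant_whitenedLaw`), and the quadratic form of `y` is `‖x‖²`. Hence one sample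
contributes `B (partialProj x) Bᴴ` to `C_st` (`sampleScatter_mulVec`), where `partialProj x` is the
partial trace of `u uᴴ`, `u = x / ‖x‖`. Only the direction `u` enters, so the generator `g`
disappears and every statistic is bounded.

The second and fourth moments of `u` follow from invariance under two kinds of isometry, a phase on
one coordinate and a 45 degree rotation in a coordinate plane, together with `∑ |u_a|² = 1`
(`integral_projEntry`, `integral_projEntry_mul`). They give `E C_st = R` and the second moment of
each contribution. By unbiasedness and independence, the error is `(1 - ρ)² V + ρ² T` with `V =
E‖C_st - R‖²` and `T = ‖I - R‖²` (`integral_sqError_Cst`). If `V + T > 0`, its only minimizer is `V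
/ (V + T)`; the stated numerator and denominator are `V` and `V + T` times `L (N + 1) / n`, `n`
being the order of the estimated factor. The sum vanishes only if `R = I` and `n = 1`.

Exchanging the two indices turns `C_p` into `C_st` (`Cp_eq_Cst_swap`), so the second claim is an
instance of the first. -/

noncomputable section

namespace KroneckerShrinkage

/-! ### The isometries used to compute moments -/

section Coordinates

variable {ι : Type*} [DecidableEq ι]

/-- Multiplication of one coordinate by `i`. -/
def coordPhase (p : ι) : (ι → ℂ) →ₗ[ℂ] (ι → ℂ) :=
  LinearMap.pi fun i => (if i = p then Complex.I else 1) • LinearMap.proj i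

lemma coordPhase_apply (p : ι) (x : ι → ℂ) (i : ι) :
    coordPhase p x i = (if i = p then Complex.I else 1) * x i := rfl

/-- The rotation by `45` degrees, composed with a reflection, in the plane of two coordinates. -/
def coordRotation (a b : ι) : (ι → ℂ) →ₗ[ℂ] (ι → ℂ) where
  toFun x i :=
    if i = a then ((√2 : ℝ) : ℂ)⁻¹ * (x a + x b)
    else if i = b then ((√2 : ℝ) : ℂ)⁻¹ * (x a - x b)
    else x i
  map_add' x y := by
    ext i
    simp only [Pi.add_apply]
    split_ifs <;> ring
  map_smul' r x := by
    ext i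
    simp only [Pi.smul_apply, smul_eq_mul, RingHom.id_apply]
    split_ifs <;> ring

lemma coordRotation_left (a b : ι) (x : ι → ℂ) :
    coordRotation a b x a = ((√2 : ℝ) : ℂ)⁻¹ * (x a + x b) := by
  simp [coordRotation]

lemma coordRotation_right {a b : ι} (hab : a ≠ b) (x : ι → ℂ) :
    coordRotation a b x b = ((√2 : ℝ) : ℂ)⁻¹ * (x a - x b) := by
  simp [coordRotation, hab.symm]

lemma coordRotation_of_ne {a b i : ι} (ha : i ≠ a) (hb : i ≠ b) (x : ι → ℂ) :
    coordRotation a b x i = x i := by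
  simp [coordRotation, ha, hb]

end Coordinates

/-! ### Moments of a unitarily invariant direction -/

section SphereMoments

variable {ι : Type*} [Fintype ι]

/-- The squared Euclidean norm on `ℂⁿ`. -/
def sqNorm (x : ι → ℂ) : ℝ := ∑ i, Complex.normSq (x i)

/-- The entry `u_a ū_b` of the rank one projection `u uᴴ`, where `u = x / ‖x‖`. -/
def projEntry (a b : ι) (x : ι → ℂ) : ℂ :=
  ((sqNorm x)⁻¹ : ℂ) * (x a * star (x b))

lemma sqNorm_nonneg (x : ι → ℂ) : 0 ≤ sqNorm x :=
  Finset.sum_nonneg fun _ _ => Complex.normSq_nonneg _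

lemma sqNorm_eq_zero {x : ι → ℂ} : sqNorm x = 0 ↔ x = 0 := by
  unfold sqNorm
  rw [Finset.sum_eq_zero_iff_of_nonneg fun _ _ => Complex.normSq_nonneg _]
  simp [funext_iff]

lemma sqNorm_eq_dotProduct (x : ι → ℂ) : ((sqNorm x : ℝ) : ℂ) = star x ⬝ᵥ x := by
  simp [sqNorm, dotProduct, Complex.normSq_eq_conj_mul_self]

lemma normSq_le_sqNorm (x : ι → ℂ) (a : ι) : Complex.normSq (x a) ≤ sqNorm x :=
  Finset.single_le_sum (f := fun i => Complex.normSq (x i))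
    (fun _ _ => Complex.normSq_nonneg _) (Finset.mem_univ a)

/-- Uses `2 |x_a| |x_b| ≤ |x_a|² + |x_b|²`. At `x = 0` the convention `0⁻¹ = 0` keeps the bound, so
integrability needs no exceptional set. -/
lemma norm_projEntry_le (a b : ι) (x : ι → ℂ) : ‖projEntry a b x‖ ≤ 1 := by
  have h : ‖x a‖ * ‖x b‖ ≤ sqNorm x := by
    have ha := normSq_le_sqNorm x a
    have hb := normSq_le_sqNorm x b
    rw [Complex.normSq_eq_norm_sq] at ha hb
    nlinarith [sq_nonneg (‖x a‖ - ‖x b‖)]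
  rw [projEntry, norm_mul, norm_mul, norm_star, norm_inv, Complex.norm_real, Real.norm_eq_abs,
    abs_of_nonneg (sqNorm_nonneg x)]
  exact inv_mul_le_one_of_le₀ h (sqNorm_nonneg x)

@[fun_prop]
lemma measurable_sqNorm : Measurable (sqNorm : (ι → ℂ) → ℝ) := by
  unfold sqNorm
  exact Finset.measurable_sum _ fun i _ => Complex.continuous_normSq.measurable.comp
    (measurable_pi_apply i)

@[fun_prop]
lemma measurable_projEntry (a b : ι) : Measurable (projEntry a b : (ι → ℂ) → ℂ) := by
  unfold projEntry
  have : Measurable fun x : ι → ℂ => star (x b) :=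
    continuous_star.measurable.comp (measurable_pi_apply b)
  fun_prop

lemma sum_projEntry_self {x : ι → ℂ} (hx : x ≠ 0) : ∑ a, projEntry a a x = 1 := by
  have h : ((sqNorm x : ℝ) : ℂ) ≠ 0 := by
    exact_mod_cast mt sqNorm_eq_zero.1 hx
  simp only [projEntry]
  rw [← Finset.mul_sum]
  have : ∑ i, x i * star (x i) = ((sqNorm x : ℝ) : ℂ) := by
    simp [sqNorm, Complex.mul_conj]
  rw [this, inv_mul_cancel₀ h]

/-- A measure invariant under all linear isometries of `ℂⁿ`. -/
def UnitarilyInvariant (ν : Measure (ι → ℂ)) : Prop :=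
  ∀ T : (ι → ℂ) →ₗ[ℂ] (ι → ℂ), (∀ x, sqNorm (T x) = sqNorm x) → ν.map T = ν

lemma UnitarilyInvariant.integral_comp {ν : Measure (ι → ℂ)} (hν : UnitarilyInvariant ν)
    {T : (ι → ℂ) →ₗ[ℂ] (ι → ℂ)} (hT : ∀ x, sqNorm (T x) = sqNorm x)
    {f : (ι → ℂ) → ℂ} (hf : Measurable f) : ∫ x, f (T x) ∂ν = ∫ x, f x ∂ν := by
  conv_rhs => rw [← hν T hT]
  rw [integral_map]
  · exact T.continuous_of_finiteDimensional.measurable.aemeasurable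
  · exact hf.aestronglyMeasurable

lemma projEntry_comp_of_sqNorm {T : (ι → ℂ) →ₗ[ℂ] (ι → ℂ)} (hT : ∀ x, sqNorm (T x) = sqNorm x)
    (a b : ι) (x : ι → ℂ) :
    projEntry a b (T x) = ((sqNorm x)⁻¹ : ℂ) * (T x a * star (T x b)) := by
  rw [projEntry, hT]

lemma integrable_projEntry (ν : Measure (ι → ℂ)) [IsFiniteMeasure ν] (a b : ι) :
    Integrable (projEntry a b) ν :=
  .of_bound (by fun_prop) 1 (.of_forall (norm_projEntry_le a b))

lemma integrable_projEntry_mul (ν : Measure (ι → ℂ)) [IsFiniteMeasure ν] (a b c d : ι) :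
    Integrable (fun x => projEntry a b x * projEntry c d x) ν := by
  refine .of_bound (by fun_prop) 1 (.of_forall fun x => ?_)
  rw [norm_mul]
  exact mul_le_one₀ (norm_projEntry_le a b x) (norm_nonneg _) (norm_projEntry_le c d x)

variable [DecidableEq ι]

lemma sqNorm_coordPhase (p : ι) (x : ι → ℂ) : sqNorm (coordPhase p x) = sqNorm x := by
  refine Finset.sum_congr rfl fun i _ => ?_
  rw [coordPhase_apply]
  split_ifs <;> simp

lemma sqNorm_coordRotation {a b : ι} (hab : a ≠ b) (x : ι → ℂ) :
    sqNorm (coordRotation a b x) = sqNorm x := by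
  rw [← sub_eq_zero, sqNorm, sqNorm, ← Finset.sum_sub_distrib,
    Fintype.sum_eq_add a b hab fun i hi => by rw [coordRotation_of_ne hi.1 hi.2, sub_self],
    coordRotation_left, coordRotation_right hab]
  have h2 : Complex.normSq ((√2 : ℝ) : ℂ)⁻¹ = 1 / 2 := by
    rw [map_inv₀, Complex.normSq_ofReal]; norm_num
  rw [map_mul, map_mul, h2, Complex.normSq_add, Complex.normSq_sub]
  ring

lemma projEntry_coordPhase (p a b : ι) (x : ι → ℂ) :
    projEntry a b (coordPhase p x) =
      (if a = p then Complex.I else 1) * (if b = p then -Complex.I else 1) * projEntry a b x := by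
  rw [projEntry_comp_of_sqNorm (sqNorm_coordPhase p), coordPhase_apply, coordPhase_apply, projEntry]
  have hI := Complex.I_mul_I
  split_ifs <;> simp <;> grind

lemma projEntry_coordRotation_left {a b : ι} (hab : a ≠ b) (x : ι → ℂ) :
    projEntry a a (coordRotation a b x) =
      2⁻¹ * ∑ i ∈ {a, b}, ∑ j ∈ {a, b}, projEntry i j x := by
  have h2 : ((√2 : ℝ) : ℂ)⁻¹ * ((√2 : ℝ) : ℂ)⁻¹ = 2⁻¹ := by
    rw [← mul_inv, ← Complex.ofReal_mul, Real.mul_self_sqrt (by norm_num)]; norm_num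
  rw [projEntry_comp_of_sqNorm (sqNorm_coordRotation hab), coordRotation_left]
  simp only [Finset.sum_pair hab, projEntry, star_mul', star_add, star_inv₀, Complex.star_def,
    Complex.conj_ofReal]
  linear_combination ((sqNorm x : ℂ)⁻¹ *
    ((x a + x b) * (starRingEnd ℂ (x a) + starRingEnd ℂ (x b)))) * h2

variable {ν : Measure (ι → ℂ)}

/-- A phase `i` on coordinate `a` shows that the integral equals `i` times itself. -/
lemma integral_projEntry_of_ne (hν : UnitarilyInvariant ν) {a b : ι} (hab : a ≠ b) :
    ∫ x, projEntry a b x ∂ν = 0 := by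
  have h := hν.integral_comp (sqNorm_coordPhase a) (measurable_projEntry a b)
  simp only [projEntry_coordPhase, if_true, if_neg hab.symm, mul_one] at h
  rw [integral_const_mul] at h
  have hI : Complex.I - 1 ≠ 0 := by simp [Complex.ext_iff]
  have : (Complex.I - 1) * ∫ x, projEntry a b x ∂ν = 0 := by linear_combination h
  exact (mul_eq_zero.1 this).resolve_left hI

/-- The phase at `p` multiplies the moment by `i` to the number of `a, c` equal to `p` minus the
number of `b, d` equal to `p`. This exponent lies between -2 and 2, so `i` detects any mismatch of
the multisets `{a, c}` and `{b, d}`, where a sign change would not. Testing `p = a` and `p = c` is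
enough. -/
lemma integral_projEntry_mul_eq_zero (hν : UnitarilyInvariant ν) {a b c d : ι}
    (h1 : ¬(a = b ∧ c = d)) (h2 : ¬(a = d ∧ c = b)) :
    ∫ x, projEntry a b x * projEntry c d x ∂ν = 0 := by
  have key : ∀ p, ((if a = p then Complex.I else 1) * (if b = p then -Complex.I else 1) *
      ((if c = p then Complex.I else 1) * (if d = p then -Complex.I else 1))) *
        ∫ x, projEntry a b x * projEntry c d x ∂ν = ∫ x, projEntry a b x * projEntry c d x ∂ν := by
    intro p
    rw [← integral_const_mul]
    refine Eq.trans (integral_congr_ae (.of_forall fun x => ?_))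
      (hν.integral_comp (sqNorm_coordPhase p)
        (f := fun x => projEntry a b x * projEntry c d x) (by fun_prop))
    simp only [projEntry_coordPhase]
    ring
  have hI : Complex.I ≠ 1 := by simp [Complex.ext_iff]
  have h11 : (-1 : ℂ) ≠ 1 := by norm_num
  by_contra h0
  have key' : ∀ p, ((if a = p then Complex.I else 1) * (if b = p then -Complex.I else 1) *
      ((if c = p then Complex.I else 1) * (if d = p then -Complex.I else 1))) = 1 :=
    fun p => by
      have := key p
      rwa [mul_eq_right₀ h0] at this
  have ka := key' a
  have kc := key' c
  by_cases hab : a = b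
  · subst hab
    have hcd : c ≠ d := fun h => h1 ⟨rfl, h⟩
    by_cases hac : a = c
    · subst hac
      simp [hcd.symm, hI] at ka
    · simp [hac, hcd.symm, hI] at kc
  · by_cases had : a = d
    · subst had
      have hcb : c ≠ b := fun h => h2 ⟨rfl, h⟩
      by_cases hac : a = c
      · subst hac
        simp [hcb.symm, hI] at ka
      · simp [hac, hcb.symm, hI] at kc
    · by_cases hac : a = c
      · simp [hac.symm, Ne.symm hab, Ne.symm had, h11] at ka
      · simp [Ne.symm hac, Ne.symm hab, Ne.symm had, hI] at ka

variable [IsProbabilityMeasure ν]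

/-- The rotation replaces `E|u_a|²` by the mean of `E|u_a|²` and `E|u_b|²`, so all of these agree;
they sum to 1 because `x ≠ 0` almost surely. -/
lemma integral_projEntry_self (hν : UnitarilyInvariant ν) (hν0 : ν {0} = 0) (a : ι) :
    ∫ x, projEntry a a x ∂ν = 1 / (Fintype.card ι : ℂ) := by
  have heq : ∀ b, ∫ x, projEntry b b x ∂ν = ∫ x, projEntry a a x ∂ν := by
    intro b
    rcases eq_or_ne a b with rfl | hab
    · rfl
    have h := hν.integral_comp (sqNorm_coordRotation hab) (measurable_projEntry a a)
    simp only [projEntry_coordRotation_left hab] at h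
    rw [integral_const_mul, integral_finsetSum _ fun i _ => integrable_finsetSum _ fun j _ =>
      integrable_projEntry ν i j] at h
    simp only [integral_finsetSum _ fun j _ => integrable_projEntry ν _ j] at h
    simp only [Finset.sum_pair hab,
      integral_projEntry_of_ne hν hab, integral_projEntry_of_ne hν hab.symm] at h
    linear_combination 2 * h
  have hsum : ∑ b, ∫ x, projEntry b b x ∂ν = 1 := by
    rw [← integral_finsetSum _ fun b _ => integrable_projEntry ν b b]
    have : (fun x => ∑ b, projEntry b b x) =ᵐ[ν] fun _ => (1 : ℂ) := by
      filter_upwards [(measure_eq_zero_iff_ae_notMem.1 hν0)] with x hx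
      exact sum_projEntry_self hx
    rw [integral_congr_ae this]; simp
  rw [Finset.sum_congr rfl fun b _ => heq b, Finset.sum_const, nsmul_eq_mul, Finset.card_univ] at hsum
  have : (Fintype.card ι : ℂ) ≠ 0 := fun h => by simp [h] at hsum
  field_simp
  linear_combination hsum

/-- Rotation invariance gives `E|u_a|⁴ = E|u_a + u_b|⁴ / 4`, which is then expanded. -/
lemma integral_projEntry_mul_self (hν : UnitarilyInvariant ν) {a b : ι} (hab : a ≠ b) :
    ∫ x, projEntry a a x * projEntry a a x ∂ν = 2 * ∫ x, projEntry a a x * projEntry b b x ∂ν := by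
  have hsymm : ∀ a b c d, ∫ x, projEntry a b x * projEntry c d x ∂ν =
      ∫ x, projEntry c d x * projEntry a b x ∂ν := fun a b c d => by simp only [mul_comm]
  have hcross : ∀ a b : ι, ∫ x, projEntry a b x * projEntry b a x ∂ν =
      ∫ x, projEntry a a x * projEntry b b x ∂ν := fun a b =>
    integral_congr_ae (.of_forall fun x => by simp only [projEntry]; ring)
  have key : ∀ a b : ι, a ≠ b → 4 * ∫ x, projEntry a a x * projEntry a a x ∂ν =
      ∫ x, projEntry a a x * projEntry a a x ∂ν + ∫ x, projEntry b b x * projEntry b b x ∂ν +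
        4 * ∫ x, projEntry a a x * projEntry b b x ∂ν := by
    intro a b hab
    have h := hν.integral_comp (sqNorm_coordRotation hab)
      (f := fun x => projEntry a a x * projEntry a a x) (by fun_prop)
    have hexp : ∀ x, projEntry a a (coordRotation a b x) * projEntry a a (coordRotation a b x) =
        4⁻¹ * ∑ i ∈ {a, b}, ∑ j ∈ {a, b}, ∑ k ∈ {a, b}, ∑ l ∈ {a, b},
          projEntry i j x * projEntry k l x := fun x => by
      simp only [projEntry_coordRotation_left hab, Finset.sum_pair hab]
      ring
    have hint := integrable_projEntry_mul ν
    simp only [hexp] at h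
    rw [integral_const_mul, integral_finsetSum _ fun i _ => integrable_finsetSum _ fun j _ =>
      integrable_finsetSum _ fun k _ => integrable_finsetSum _ fun l _ => hint i j k l] at h
    simp only [integral_finsetSum _ fun j _ => integrable_finsetSum _ fun k _ =>
      integrable_finsetSum _ fun l _ => hint _ j k l] at h
    simp only [integral_finsetSum _ fun k _ => integrable_finsetSum _ fun l _ => hint _ _ k l] at h
    simp only [integral_finsetSum _ fun l _ => hint _ _ _ l] at h
    -- Ten of the sixteen terms are unbalanced and vanish; two pure fourth moments and four equal
    -- mixed moments remain.
    have hz : ∀ {a b c d : ι}, ¬(a = b ∧ c = d) → ¬(a = d ∧ c = b) →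
      ∫ x, projEntry a b x * projEntry c d x ∂ν = 0 := integral_projEntry_mul_eq_zero hν
    simp only [Finset.sum_pair hab] at h
    rw [hcross a b, hcross b a, hsymm b b a a,
      hz (a := a) (b := a) (c := a) (d := b) (by grind) (by grind),
      hz (a := a) (b := a) (c := b) (d := a) (by grind) (by grind),
      hz (a := a) (b := b) (c := a) (d := a) (by grind) (by grind),
      hz (a := a) (b := b) (c := a) (d := b) (by grind) (by grind),
      hz (a := a) (b := b) (c := b) (d := b) (by grind) (by grind),
      hz (a := b) (b := a) (c := a) (d := a) (by grind) (by grind),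
      hz (a := b) (b := a) (c := b) (d := a) (by grind) (by grind),
      hz (a := b) (b := a) (c := b) (d := b) (by grind) (by grind),
      hz (a := b) (b := b) (c := a) (d := b) (by grind) (by grind),
      hz (a := b) (b := b) (c := b) (d := a) (by grind) (by grind)] at h
    linear_combination -4 * h
  have h1 := key a b hab
  have h2 := key b a hab.symm
  rw [hsymm b b a a] at h2
  -- These weights eliminate `E|u_b|⁴` from the two relations.
  linear_combination (3 / 8) * h1 + (1 / 8) * h2

/-- The second moments of the projection onto a unitarily invariant direction. -/
lemma integral_projEntry (hν : UnitarilyInvariant ν) (hν0 : ν {0} = 0) (a b : ι) :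
    ∫ x, projEntry a b x ∂ν = if a = b then 1 / (Fintype.card ι : ℂ) else 0 := by
  split_ifs with h
  · rw [h, integral_projEntry_self hν hν0]
  · exact integral_projEntry_of_ne hν h

/-- With `q = E|u_a|⁴`, each mixed moment is `q / 2`. Multiplying `∑ |u_b|² = 1` by `|u_a|²` and
integrating gives `q + (N - 1) q / 2 = 1 / N`, which determines `q`. -/
lemma integral_projEntry_mul_diag (hν : UnitarilyInvariant ν) (hν0 : ν {0} = 0) (a b : ι) :
    ∫ x, projEntry a a x * projEntry b b x ∂ν =
      (1 + if a = b then 1 else 0) / ((Fintype.card ι : ℂ) * (Fintype.card ι + 1)) := by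
  have : Nonempty ι := ⟨a⟩
  have hN : (Fintype.card ι : ℂ) ≠ 0 := by simp
  have hN1 : (Fintype.card ι : ℂ) + 1 ≠ 0 := by exact_mod_cast Nat.succ_ne_zero (Fintype.card ι)
  have hsum : ∑ b, ∫ x, projEntry a a x * projEntry b b x ∂ν = 1 / (Fintype.card ι : ℂ) := by
    rw [← integral_projEntry_self hν hν0 a,
      ← integral_finsetSum _ fun b _ => integrable_projEntry_mul ν a a b b]
    refine integral_congr_ae ?_
    filter_upwards [measure_eq_zero_iff_ae_notMem.1 hν0] with x hx
    rw [← Finset.mul_sum, sum_projEntry_self hx, mul_one]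
  have hother : ∀ c ∈ Finset.univ.erase a, ∫ x, projEntry a a x * projEntry c c x ∂ν =
      (∫ x, projEntry a a x * projEntry a a x ∂ν) / 2 := fun c hc => by
    rw [integral_projEntry_mul_self hν (Finset.ne_of_mem_erase hc).symm]; ring
  rw [← Finset.add_sum_erase _ _ (Finset.mem_univ a), Finset.sum_congr rfl hother,
    Finset.sum_const, nsmul_eq_mul, Finset.card_erase_of_mem (Finset.mem_univ a),
    Finset.card_univ, Nat.cast_sub Fintype.card_pos] at hsum
  have hself : ∫ x, projEntry a a x * projEntry a a x ∂ν =
      2 / ((Fintype.card ι : ℂ) * (Fintype.card ι + 1)) := by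
    field_simp at hsum ⊢
    push_cast at hsum
    linear_combination hsum
  split_ifs with h
  · rw [← h, hself]; norm_num
  · have := integral_projEntry_mul_self hν h
    rw [hself] at this
    linear_combination -(1 / 2) * this

/-- The fourth moments of the projection onto a unitarily invariant direction. -/
lemma integral_projEntry_mul (hν : UnitarilyInvariant ν) (hν0 : ν {0} = 0) (a b c d : ι) :
    ∫ x, projEntry a b x * projEntry c d x ∂ν =
      ((if a = b then 1 else 0) * (if c = d then 1 else 0) +
        (if a = d then 1 else 0) * (if c = b then 1 else 0)) /
        ((Fintype.card ι : ℂ) * (Fintype.card ι + 1)) := by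
  by_cases h1 : a = b ∧ c = d
  · obtain ⟨rfl, rfl⟩ := h1
    rw [integral_projEntry_mul_diag hν hν0]
    by_cases h : a = c
    · simp [h]
    · simp [h]
  by_cases h2 : a = d ∧ c = b
  · obtain ⟨rfl, rfl⟩ := h2
    have : ∀ x : ι → ℂ, projEntry a c x * projEntry c a x = projEntry a a x * projEntry c c x :=
      fun x => by simp only [projEntry]; ring
    simp only [this]
    rw [integral_projEntry_mul_diag hν hν0]
    have hac : a ≠ c := fun h => h1 ⟨h, h.symm⟩
    simp [hac]
  · rw [integral_projEntry_mul_eq_zero hν h1 h2]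
    have e1 : ((if a = b then 1 else 0) * (if c = d then 1 else 0) : ℂ) = 0 := by
      rw [mul_eq_zero]; simpa [imp_iff_not_or] using h1
    have e2 : ((if a = d then 1 else 0) * (if c = b then 1 else 0) : ℂ) = 0 := by
      rw [mul_eq_zero]; simpa [imp_iff_not_or] using h2
    rw [e1, e2]; simp

end SphereMoments

/-! ### Whitening an elliptically symmetric law -/

section EllipticalLaw

lemma exists_isUnit_mul_conjTranspose {n : Type*} [Fintype n] [DecidableEq n] {R : Matrix n n ℂ}
    (hR : R.PosDef) : ∃ B : Matrix n n ℂ, IsUnit B.det ∧ R = B * Bᴴ := by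
  open scoped MatrixOrder in
  obtain ⟨B, hB⟩ := CStarAlgebra.nonneg_iff_eq_star_mul_self.mp hR.posSemidef.nonneg
  refine ⟨Bᴴ, ?_, by rw [Matrix.conjTranspose_conjTranspose, hB, Matrix.star_eq_conjTranspose]⟩
  have h := (Matrix.isUnit_iff_isUnit_det R).1 hR.isUnit
  rw [hB, Matrix.star_eq_conjTranspose, Matrix.det_mul] at h
  exact isUnit_of_mul_isUnit_left h

variable {n : Type*} [Fintype n]

lemma measurable_mulVec (M : Matrix n n ℂ) : Measurable fun y : n → ℂ => M *ᵥ y :=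
  (show Continuous fun y : n → ℂ => M *ᵥ y by fun_prop).measurable

variable [DecidableEq n]

lemma quadForm_mulVec {R M : Matrix n n ℂ} (hM : IsUnit M.det) (hR : R = M * Mᴴ) (x : n → ℂ) :
    quadForm R (M *ᵥ x) = sqNorm x := by
  have hM' : IsUnit Mᴴ.det := by
    rw [Matrix.det_conjTranspose]; exact hM.star
  have key : Mᴴ * R⁻¹ * M = 1 := by
    rw [hR, Matrix.mul_inv_rev, ← Matrix.mul_assoc, Matrix.mul_nonsing_inv _ hM', Matrix.one_mul,
      Matrix.nonsing_inv_mul _ hM]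
  rw [quadForm, Matrix.star_mulVec, ← Matrix.dotProduct_mulVec, Matrix.mulVec_mulVec,
    Matrix.mulVec_mulVec, key, Matrix.one_mulVec, ← sqNorm_eq_dotProduct, Complex.ofReal_re]

@[fun_prop]
lemma measurable_quadForm (R : Matrix n n ℂ) : Measurable (quadForm R) := by
  have : Continuous (quadForm R) := by unfold quadForm; fun_prop
  exact this.measurable

/-- An injective linear map scales Lebesgue measure by a constant `k`, and the density is invariant
under `T`, so the law is scaled by `k` too. Comparing total masses gives `k = 1` without computing a
determinant. -/
lemma map_cesLaw_of_quadForm_eq {R : Matrix n n ℂ} {c : ℝ} {g : ℝ → ℝ} (hg : Measurable g)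
    [IsProbabilityMeasure (cesLaw R c g)] (T : (n → ℂ) →ₗ[ℂ] (n → ℂ))
    (hinj : Function.Injective T) (hT : ∀ v, quadForm R (T v) = quadForm R v) :
    (cesLaw R c g).map T = cesLaw R c g := by
  have hTm : Measurable T := T.continuous_of_finiteDimensional.measurable
  obtain ⟨k, hk⟩ : ∃ k : ENNReal, (volume : Measure (n → ℂ)).map T = k • volume := by
    have hdet : LinearMap.det (T.restrictScalars ℝ) ≠ 0 := by
      have h : IsUnit (T.restrictScalars ℝ) := by
        rw [Module.End.isUnit_iff]
        exact ⟨hinj, LinearMap.injective_iff_surjective.1 hinj⟩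
      exact (h.map LinearMap.det).ne_zero
    exact ⟨_, Measure.map_linearMap_addHaar_eq_smul_addHaar volume hdet⟩
  have hmap : (cesLaw R c g).map T = k • cesLaw R c g := by
    ext s hs
    rw [Measure.map_apply hTm hs, Measure.smul_apply, cesLaw, withDensity_apply _ (hTm hs),
      withDensity_apply _ hs, ← lintegral_smul_measure, ← Measure.restrict_smul, ← hk,
      setLIntegral_map hs (by fun_prop) hTm]
    simp only [hT]
  have hmass := congrArg (fun μ : Measure (n → ℂ) => μ Set.univ) hmap
  simp only [Measure.map_apply hTm MeasurableSet.univ, Set.preimage_univ, measure_univ,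
    Measure.smul_apply, smul_eq_mul, mul_one] at hmass
  rw [hmap, ← hmass, one_smul]

lemma cesLaw_singleton_zero [Nonempty n] (R : Matrix n n ℂ) (c : ℝ) (g : ℝ → ℝ) :
    cesLaw R c g {0} = 0 :=
  withDensity_absolutelyContinuous _ _ (measure_singleton 0)

/-- The law of `M⁻¹ y`, where `y` is elliptically symmetric with scatter matrix `M Mᴴ`. -/
def whitenedLaw (M R : Matrix n n ℂ) (c : ℝ) (g : ℝ → ℝ) : Measure (n → ℂ) :=
  (cesLaw R c g).map fun y => M⁻¹ *ᵥ y

lemma map_mulVec_whitenedLaw {M : Matrix n n ℂ} (hM : IsUnit M.det) (R : Matrix n n ℂ) (c : ℝ)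
    (g : ℝ → ℝ) : (whitenedLaw M R c g).map (fun x => M *ᵥ x) = cesLaw R c g := by
  rw [whitenedLaw, Measure.map_map (measurable_mulVec M) (measurable_mulVec M⁻¹)]
  have : (fun x => M *ᵥ x) ∘ (fun y => M⁻¹ *ᵥ y) = id := by
    ext1 y
    simp [Matrix.mulVec_mulVec, Matrix.mul_nonsing_inv _ hM]
  rw [this, Measure.map_id]

lemma isProbabilityMeasure_whitenedLaw (M R : Matrix n n ℂ) (c : ℝ) (g : ℝ → ℝ)
    [IsProbabilityMeasure (cesLaw R c g)] : IsProbabilityMeasure (whitenedLaw M R c g) :=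
  Measure.isProbabilityMeasure_map (measurable_mulVec M⁻¹).aemeasurable

lemma whitenedLaw_singleton_zero [Nonempty n] {M : Matrix n n ℂ} (hM : IsUnit M.det)
    (R : Matrix n n ℂ) (c : ℝ) (g : ℝ → ℝ) : whitenedLaw M R c g {0} = 0 := by
  rw [whitenedLaw, Measure.map_apply (measurable_mulVec M⁻¹) (measurableSet_singleton 0)]
  have : (fun y => M⁻¹ *ᵥ y) ⁻¹' {0} = {0} := by
    ext y
    simp only [Set.mem_preimage, Set.mem_singleton_iff]
    refine ⟨fun h => ?_, fun h => by rw [h, Matrix.mulVec_zero]⟩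
    have := congrArg (fun z => M *ᵥ z) h
    simpa [Matrix.mulVec_mulVec, Matrix.mul_nonsing_inv _ hM] using this
  rw [this, cesLaw_singleton_zero]

/-- If `T` is an isometry, then `M T M⁻¹` preserves the form of `R`, hence the elliptical law;
conjugating back gives the invariance of the whitened law. -/
lemma unitarilyInvariant_whitenedLaw {M R : Matrix n n ℂ} (hM : IsUnit M.det) (hR : R = M * Mᴴ)
    {c : ℝ} {g : ℝ → ℝ} (hg : Measurable g) [IsProbabilityMeasure (cesLaw R c g)] :
    UnitarilyInvariant (whitenedLaw M R c g) := by
  intro T hT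
  have hTm : Measurable T := T.continuous_of_finiteDimensional.measurable
  have hinv : ∀ v, M *ᵥ (M⁻¹ *ᵥ v) = v := fun v => by
    simp [Matrix.mulVec_mulVec, Matrix.mul_nonsing_inv _ hM]
  have hinv' : ∀ v, M⁻¹ *ᵥ (M *ᵥ v) = v := fun v => by
    simp [Matrix.mulVec_mulVec, Matrix.nonsing_inv_mul _ hM]
  have hTinj : Function.Injective T := by
    rw [injective_iff_map_eq_zero]
    intro x hx
    rw [← sqNorm_eq_zero, ← hT, hx, sqNorm_eq_zero]
  have hS := map_cesLaw_of_quadForm_eq (R := R) (c := c) hg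
    (M.mulVecLin ∘ₗ T ∘ₗ M⁻¹.mulVecLin) ?_ ?_
  · conv_rhs => rw [whitenedLaw, ← hS]
    rw [whitenedLaw, Measure.map_map hTm (measurable_mulVec _),
      Measure.map_map (measurable_mulVec _) (LinearMap.continuous_of_finiteDimensional _).measurable]
    congr 1
    ext1 v
    simp [hinv', -Matrix.mulVec_mulVec]
  · intro v w h
    simp only [LinearMap.comp_apply, Matrix.mulVecLin_apply] at h
    have h := hTinj (Function.LeftInverse.injective hinv' h)
    exact Function.LeftInverse.injective hinv h
  · intro v
    simp only [LinearMap.comp_apply, Matrix.mulVecLin_apply]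
    rw [quadForm_mulVec hM hR, hT, ← quadForm_mulVec hM hR, hinv]

end EllipticalLaw

/-! ### One sample in whitened coordinates -/

section SampleMoments

variable {n m : ℕ}

/-- The contribution `(Yᴴ Rp⁻¹ Y)ᵀ / (yᴴ (Rst ⊗ Rp)⁻¹ y)` of one sample to `C_st`. -/
def sampleScatter (Rst : Matrix (Fin n) (Fin n) ℂ) (Rp : Matrix (Fin m) (Fin m) ℂ)
    (y : Fin n × Fin m → ℂ) : Matrix (Fin n) (Fin n) ℂ :=
  (quadForm (Rst ⊗ₖ Rp) y)⁻¹ • ((unvec y)ᴴ * Rp⁻¹ * unvec y)ᵀ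

/-- The partial trace over the second factor of the projection onto the line through `x`. -/
def partialProj (x : Fin n × Fin m → ℂ) : Matrix (Fin n) (Fin n) ℂ :=
  Matrix.of fun a b => ∑ j, projEntry (a, j) (b, j) x

lemma unvec_kronecker_mulVec (B : Matrix (Fin n) (Fin n) ℂ) (A : Matrix (Fin m) (Fin m) ℂ)
    (x : Fin n × Fin m → ℂ) : unvec ((B ⊗ₖ A) *ᵥ x) = A * unvec x * Bᵀ := by
  have h := Matrix.kronecker_mulVec_vec A (unvec x) B
  ext j i
  exact congrFun h (i, j)

lemma partialProj_eq_smul (x : Fin n × Fin m → ℂ) :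
    partialProj x = (sqNorm x)⁻¹ • ((unvec x)ᴴ * unvec x)ᵀ := by
  ext a b
  simp only [partialProj, projEntry, unvec, Matrix.of_apply, Matrix.smul_apply,
    Matrix.transpose_apply, Matrix.mul_apply, Matrix.conjTranspose_apply, Finset.smul_sum,
    Complex.real_smul, Complex.ofReal_inv]
  exact Finset.sum_congr rfl fun j _ => by ring

/-- Reshaping turns `(B ⊗ A) x` into `A X Bᵀ`. The factor `A` cancels against `Rp⁻¹`, and the outer
transpose brings the `B` factors to the form `B · Bᴴ`. -/
lemma sampleScatter_mulVec {Rst B : Matrix (Fin n) (Fin n) ℂ} {Rp A : Matrix (Fin m) (Fin m) ℂ}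
    (hB : IsUnit B.det) (hRst : Rst = B * Bᴴ) (hA : IsUnit A.det) (hRp : Rp = A * Aᴴ)
    (x : Fin n × Fin m → ℂ) :
    sampleScatter Rst Rp ((B ⊗ₖ A) *ᵥ x) = B * partialProj x * Bᴴ := by
  have hBA : IsUnit (B ⊗ₖ A).det := by
    rw [Matrix.det_kronecker]; exact (hB.pow _).mul (hA.pow _)
  have hR : Rst ⊗ₖ Rp = (B ⊗ₖ A) * (B ⊗ₖ A)ᴴ := by
    rw [hRst, hRp, Matrix.conjTranspose_kronecker, Matrix.mul_kronecker_mul]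
  have hA' : IsUnit Aᴴ.det := by
    rw [Matrix.det_conjTranspose]; exact hA.star
  have key : Aᴴ * Rp⁻¹ * A = 1 := by
    rw [hRp, Matrix.mul_inv_rev, ← Matrix.mul_assoc, Matrix.mul_nonsing_inv _ hA', Matrix.one_mul,
      Matrix.nonsing_inv_mul _ hA]
  rw [sampleScatter, quadForm_mulVec hBA hR, unvec_kronecker_mulVec, partialProj_eq_smul]
  have : (A * unvec x * Bᵀ)ᴴ * Rp⁻¹ * (A * unvec x * Bᵀ) =
      (Bᵀ)ᴴ * ((unvec x)ᴴ * unvec x) * Bᵀ := by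
    calc _ = (Bᵀ)ᴴ * ((unvec x)ᴴ * (Aᴴ * Rp⁻¹ * A) * unvec x) * Bᵀ := by
          simp only [Matrix.conjTranspose_mul, Matrix.mul_assoc]
      _ = _ := by rw [key, Matrix.mul_one]
  rw [this, Matrix.mul_smul, Matrix.smul_mul, Matrix.transpose_mul, Matrix.transpose_mul,
    Matrix.transpose_transpose, ← Matrix.mul_assoc]
  rfl

lemma partialProj_conj (x : Fin n × Fin m → ℂ) (a b : Fin n) :
    star (partialProj x a b) = partialProj x b a := by
  simp only [partialProj, Matrix.of_apply, star_sum, projEntry]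
  refine Finset.sum_congr rfl fun j _ => ?_
  simp only [star_mul', star_inv₀, Complex.star_def, Complex.conj_ofReal]
  rw [Complex.conj_conj]
  ring

lemma conjTranspose_partialProj (x : Fin n × Fin m → ℂ) : (partialProj x)ᴴ = partialProj x := by
  ext a b
  exact partialProj_conj x b a

variable {ν : Measure (Fin n × Fin m → ℂ)} [IsProbabilityMeasure ν]

lemma measurable_partialProj (a b : Fin n) :
    Measurable fun x : Fin n × Fin m → ℂ => partialProj x a b := by
  simp only [partialProj, Matrix.of_apply]
  fun_prop

lemma norm_partialProj_le (a b : Fin n) (x : Fin n × Fin m → ℂ) :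
    ‖partialProj x a b‖ ≤ m := by
  rw [partialProj, Matrix.of_apply]
  refine (norm_sum_le_of_le _ fun j _ => norm_projEntry_le (a, j) (b, j) x).trans ?_
  simp

lemma integral_partialProj (hν : UnitarilyInvariant ν) (hν0 : ν {0} = 0) (hm : 0 < m)
    (a b : Fin n) : ∫ x, partialProj x a b ∂ν = (1 / n : ℂ) * (1 : Matrix (Fin n) (Fin n) ℂ) a b := by
  simp only [partialProj, Matrix.of_apply]
  rw [integral_finsetSum _ fun j _ => integrable_projEntry ν _ _]
  simp only [integral_projEntry hν hν0, Prod.mk.injEq, and_true, Finset.sum_const,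
    Finset.card_univ, Fintype.card_prod, Fintype.card_fin, nsmul_eq_mul, Matrix.one_apply]
  have : (m : ℂ) ≠ 0 := by exact_mod_cast hm.ne'
  split_ifs
  · push_cast
    field_simp
  · simp

/-- In the double sum over the traced indices `j, k`, the first pairing leaves both free and
contributes `m²`; the second forces `j = k` and contributes `m`. -/
lemma integral_partialProj_mul (hν : UnitarilyInvariant ν) (hν0 : ν {0} = 0)
    (a b c d : Fin n) : ∫ x, partialProj x a b * partialProj x c d ∂ν =
      ((m : ℂ) ^ 2 * ((1 : Matrix (Fin n) (Fin n) ℂ) a b * (1 : Matrix (Fin n) (Fin n) ℂ) c d) +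
        m * ((1 : Matrix (Fin n) (Fin n) ℂ) d a * (1 : Matrix (Fin n) (Fin n) ℂ) b c)) /
        ((n * m : ℂ) * (n * m + 1)) := by
  simp only [partialProj, Matrix.of_apply, Finset.sum_mul_sum]
  rw [integral_finsetSum _ fun j _ => integrable_finsetSum _ fun k _ =>
    integrable_projEntry_mul ν _ _ _ _]
  simp only [integral_finsetSum _ fun k _ => integrable_projEntry_mul ν (_, _) (_, _) (_, k) (_, k)]
  simp only [integral_projEntry_mul hν hν0, Prod.mk.injEq, and_true,
    Fintype.card_prod, Fintype.card_fin, Matrix.one_apply, ← Finset.sum_div, Nat.cast_mul]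
  congr 1
  have h : ∀ j k : Fin m, ((if a = d ∧ j = k then 1 else 0) * (if c = b ∧ k = j then 1 else 0) : ℂ) =
      if j = k then ((if d = a then 1 else 0) * (if b = c then 1 else 0)) else 0 := by
    intro j k
    by_cases h1 : j = k <;> by_cases h2 : a = d <;> by_cases h3 : c = b <;>
      simp [h1, h2, h3, Ne.symm]
  simp only [h, Finset.sum_add_distrib, Finset.sum_ite_eq, Finset.mem_univ, if_true,
    Finset.sum_const, Finset.card_univ, Fintype.card_fin, nsmul_eq_mul]
  ring

end SampleMoments

/-! ### Mean and second moment of one contribution -/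

section ScatterMoments

variable {n m : ℕ}

lemma continuous_unvec : Continuous (unvec : (Fin n × Fin m → ℂ) → Matrix (Fin m) (Fin n) ℂ) :=
  continuous_pi fun j => continuous_pi fun i => continuous_apply (i, j)

lemma measurable_sampleScatter (Rst : Matrix (Fin n) (Fin n) ℂ) (Rp : Matrix (Fin m) (Fin m) ℂ)
    (a b : Fin n) : Measurable fun y => sampleScatter Rst Rp y a b := by
  have h : Continuous fun y : Fin n × Fin m → ℂ => ((unvec y)ᴴ * Rp⁻¹ * unvec y)ᵀ a b := by
    have := continuous_unvec (n := n) (m := m)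
    exact ((((this.matrix_conjTranspose.matrix_mul continuous_const).matrix_mul
      this).matrix_transpose).matrix_elem a b)
  exact (measurable_quadForm (Rst ⊗ₖ Rp)).inv.smul h.measurable

variable {Rst : Matrix (Fin n) (Fin n) ℂ} {Rp : Matrix (Fin m) (Fin m) ℂ}

/-- Boundedness makes all moments finite with no integrability assumption on `g`. -/
lemma exists_norm_sampleScatter_le (hRst : Rst.PosDef) (hRp : Rp.PosDef) (a b : Fin n) :
    ∃ K, ∀ y, ‖sampleScatter Rst Rp y a b‖ ≤ K := by
  obtain ⟨B, hB, hRB⟩ := exists_isUnit_mul_conjTranspose hRst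
  obtain ⟨A, hA, hRA⟩ := exists_isUnit_mul_conjTranspose hRp
  have hBA : IsUnit (B ⊗ₖ A).det := by
    rw [Matrix.det_kronecker]; exact (hB.pow _).mul (hA.pow _)
  refine ⟨∑ d, (∑ c, ‖B a c‖ * m) * ‖Bᴴ d b‖, fun y => ?_⟩
  have hy : y = (B ⊗ₖ A) *ᵥ ((B ⊗ₖ A)⁻¹ *ᵥ y) := by
    rw [Matrix.mulVec_mulVec, Matrix.mul_nonsing_inv _ hBA, Matrix.one_mulVec]
  rw [hy, sampleScatter_mulVec hB hRB hA hRA, Matrix.mul_apply]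
  refine norm_sum_le_of_le _ fun d _ => ?_
  rw [norm_mul, Matrix.mul_apply]
  gcongr
  refine norm_sum_le_of_le _ fun c _ => ?_
  rw [norm_mul]
  gcongr
  exact norm_partialProj_le _ _ _

/-- Separates the random entries, those of `W`, from the fixed ones, so that the fourth moments
apply termwise. -/
lemma trace_mul_mul_mul (W S : Matrix (Fin n) (Fin n) ℂ) :
    (W * S * (W * S)).trace = ∑ a, ∑ c, ∑ b, ∑ d, W a b * W c d * (S b c * S d a) := by
  simp only [Matrix.trace, Matrix.diag_apply, Matrix.mul_apply, Finset.sum_mul_sum]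
  refine Finset.sum_congr rfl fun a _ => Finset.sum_congr rfl fun c _ =>
    Finset.sum_congr rfl fun b _ => Finset.sum_congr rfl fun d _ => by ring

lemma sum_mul_star_eq_trace (Z : Matrix (Fin n) (Fin n) ℂ) :
    ∑ a, ∑ b, Z a b * star (Z a b) = (Z * Zᴴ).trace := by
  simp [Matrix.trace, Matrix.mul_apply]

lemma sum_norm_sq_eq_trace_sq {R : Matrix (Fin n) (Fin n) ℂ} (hR : R.IsHermitian) :
    ∑ a, ∑ b, ‖R a b‖ ^ 2 = (R ^ 2).trace.re := by
  have h := sum_mul_star_eq_trace R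
  rw [hR.eq, ← sq] at h
  rw [← h]
  simp only [Complex.re_sum, Complex.star_def, Complex.mul_conj, Complex.ofReal_re,
    Complex.normSq_eq_norm_sq]

lemma ofReal_trace_re {R : Matrix (Fin n) (Fin n) ℂ} (hR : R.IsHermitian) :
    ((R.trace.re : ℝ) : ℂ) = R.trace := by
  rw [← Complex.conj_eq_iff_re, ← Complex.star_def, ← Matrix.trace_conjTranspose, hR.eq]

section Whitened

variable {ν : Measure (Fin n × Fin m → ℂ)} [IsProbabilityMeasure ν]

lemma integrable_partialProj (a b : Fin n) : Integrable (fun x => partialProj x a b) ν :=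
  .of_bound (measurable_partialProj a b).aestronglyMeasurable m
    (.of_forall (norm_partialProj_le a b))

lemma integrable_partialProj_mul (a b c d : Fin n) :
    Integrable (fun x => partialProj x a b * partialProj x c d) ν := by
  refine .of_bound ((measurable_partialProj a b).mul
    (measurable_partialProj c d)).aestronglyMeasurable (m * m) (.of_forall fun x => ?_)
  rw [norm_mul]
  exact mul_le_mul (norm_partialProj_le a b x) (norm_partialProj_le c d x) (norm_nonneg _)
    (by positivity)

lemma integral_conj_partialProj (hν : UnitarilyInvariant ν) (hν0 : ν {0} = 0) (hm : 0 < m)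
    (B : Matrix (Fin n) (Fin n) ℂ) (a b : Fin n) :
    ∫ x, (B * partialProj x * Bᴴ) a b ∂ν = (1 / n : ℂ) * (B * Bᴴ) a b := by
  simp only [Matrix.mul_apply]
  have hi : ∀ c d : Fin n, Integrable (fun x => B a d * partialProj x d c) ν :=
    fun c d => (integrable_partialProj d c).const_mul _
  rw [integral_finsetSum _ fun c _ => (integrable_finsetSum _ fun d _ => hi c d).mul_const _]
  simp only [integral_mul_const, integral_finsetSum _ fun d _ => hi _ d, integral_const_mul,
    integral_partialProj hν hν0 hm, Matrix.one_apply]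
  simp only [mul_ite, mul_one, mul_zero, Finset.sum_ite_eq', Finset.mem_univ, if_true,
    Finset.mul_sum]
  exact Finset.sum_congr rfl fun c _ => by ring

lemma integral_trace_partialProj (hν : UnitarilyInvariant ν) (hν0 : ν {0} = 0)
    (S : Matrix (Fin n) (Fin n) ℂ) :
    ∫ x, (partialProj x * S * (partialProj x * S)).trace ∂ν =
      ((m : ℂ) ^ 2 * (S * S).trace + m * S.trace ^ 2) / ((n * m : ℂ) * (n * m + 1)) := by
  have hi : ∀ a b c d : Fin n,
      Integrable (fun x => partialProj x a b * partialProj x c d * (S b c * S d a)) ν :=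
    fun a b c d => (integrable_partialProj_mul a b c d).mul_const _
  simp only [trace_mul_mul_mul]
  rw [integral_finsetSum _ fun a _ => integrable_finsetSum _ fun c _ =>
    integrable_finsetSum _ fun b _ => integrable_finsetSum _ fun d _ => hi a b c d]
  simp only [integral_finsetSum _ fun c _ => integrable_finsetSum _ fun b _ =>
    integrable_finsetSum _ fun d _ => hi _ b c d]
  simp only [integral_finsetSum _ fun b _ => integrable_finsetSum _ fun d _ => hi _ b _ d]
  simp only [integral_finsetSum _ fun d _ => hi _ _ _ d, integral_mul_const,
    integral_partialProj_mul hν hν0]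
  simp only [div_mul_eq_mul_div, ← Finset.sum_div, add_mul, Finset.sum_add_distrib]
  congr 2
  · simp only [Matrix.one_apply, Matrix.trace, Matrix.diag_apply, Matrix.mul_apply, Finset.mul_sum,
      mul_ite, ite_mul, mul_one, mul_zero, zero_mul, Finset.sum_ite_eq, Finset.mem_univ, if_true]
  · have h : ∀ a c b d : Fin n, (m : ℂ) * ((1 : Matrix (Fin n) (Fin n) ℂ) d a *
        (1 : Matrix (Fin n) (Fin n) ℂ) b c) * (S b c * S d a) =
        if b = c then (if d = a then m * (S c c * S a a) else 0) else 0 := by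
      intro a c b d
      simp only [Matrix.one_apply]
      split_ifs with h1 h2 <;> simp [*]
    simp only [h, Finset.sum_ite_irrel, Finset.sum_const_zero, Finset.sum_ite_eq', Finset.mem_univ,
      if_true, Matrix.trace, Matrix.diag_apply, ← Finset.mul_sum, ← Finset.sum_mul]
    ring

end Whitened

variable {c : ℝ} {g : ℝ → ℝ}

lemma integral_cesLaw_kronecker {B : Matrix (Fin n) (Fin n) ℂ} {A : Matrix (Fin m) (Fin m) ℂ}
    (hB : IsUnit B.det) (hRB : Rst = B * Bᴴ) (hA : IsUnit A.det) (hRA : Rp = A * Aᴴ)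
    {f : Matrix (Fin n) (Fin n) ℂ → ℂ} (hf : Measurable fun y => f (sampleScatter Rst Rp y)) :
    ∫ y, f (sampleScatter Rst Rp y) ∂(cesLaw (Rst ⊗ₖ Rp) c g) =
      ∫ x, f (B * partialProj x * Bᴴ) ∂(whitenedLaw (B ⊗ₖ A) (Rst ⊗ₖ Rp) c g) := by
  have hBA : IsUnit (B ⊗ₖ A).det := by
    rw [Matrix.det_kronecker]; exact (hB.pow _).mul (hA.pow _)
  conv_lhs => rw [← map_mulVec_whitenedLaw hBA]
  rw [integral_map (measurable_mulVec _).aemeasurable hf.aestronglyMeasurable]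
  simp only [sampleScatter_mulVec hB hRB hA hRA]

lemma integral_sampleScatter (hn : 0 < n) (hm : 0 < m) (hRst : Rst.PosDef) (hRp : Rp.PosDef)
    (hg : Measurable g) [IsProbabilityMeasure (cesLaw (Rst ⊗ₖ Rp) c g)] (a b : Fin n) :
    ∫ y, sampleScatter Rst Rp y a b ∂(cesLaw (Rst ⊗ₖ Rp) c g) = (1 / n : ℂ) * Rst a b := by
  obtain ⟨B, hB, hRB⟩ := exists_isUnit_mul_conjTranspose hRst
  obtain ⟨A, hA, hRA⟩ := exists_isUnit_mul_conjTranspose hRp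
  have hBA : IsUnit (B ⊗ₖ A).det := by
    rw [Matrix.det_kronecker]; exact (hB.pow _).mul (hA.pow _)
  have hR : Rst ⊗ₖ Rp = (B ⊗ₖ A) * (B ⊗ₖ A)ᴴ := by
    rw [hRB, hRA, Matrix.conjTranspose_kronecker, Matrix.mul_kronecker_mul]
  have : Nonempty (Fin n × Fin m) := ⟨(⟨0, hn⟩, ⟨0, hm⟩)⟩
  have := isProbabilityMeasure_whitenedLaw (B ⊗ₖ A) (Rst ⊗ₖ Rp) c g
  rw [integral_cesLaw_kronecker hB hRB hA hRA (f := fun Z => Z a b)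
      (measurable_sampleScatter Rst Rp a b),
    integral_conj_partialProj (unitarilyInvariant_whitenedLaw hBA hR hg)
      (whitenedLaw_singleton_zero hBA _ _ _) hm, ← hRB]

lemma integral_sum_norm_sq_sampleScatter (hn : 0 < n) (hm : 0 < m) (hRst : Rst.PosDef)
    (hRp : Rp.PosDef) (hg : Measurable g) [IsProbabilityMeasure (cesLaw (Rst ⊗ₖ Rp) c g)] :
    ∫ y, ∑ a, ∑ b, ‖sampleScatter Rst Rp y a b‖ ^ 2 ∂(cesLaw (Rst ⊗ₖ Rp) c g) =
      ((m : ℝ) ^ 2 * (Rst ^ 2).trace.re + m * Rst.trace.re ^ 2) / ((n * m : ℝ) * (n * m + 1)) := by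
  obtain ⟨B, hB, hRB⟩ := exists_isUnit_mul_conjTranspose hRst
  obtain ⟨A, hA, hRA⟩ := exists_isUnit_mul_conjTranspose hRp
  have hBA : IsUnit (B ⊗ₖ A).det := by
    rw [Matrix.det_kronecker]; exact (hB.pow _).mul (hA.pow _)
  have hR : Rst ⊗ₖ Rp = (B ⊗ₖ A) * (B ⊗ₖ A)ᴴ := by
    rw [hRB, hRA, Matrix.conjTranspose_kronecker, Matrix.mul_kronecker_mul]
  have : Nonempty (Fin n × Fin m) := ⟨(⟨0, hn⟩, ⟨0, hm⟩)⟩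
  have := isProbabilityMeasure_whitenedLaw (B ⊗ₖ A) (Rst ⊗ₖ Rp) c g
  have htr : (Bᴴ * B).trace = Rst.trace := by rw [Matrix.trace_mul_comm, hRB]
  have htr2 : (Bᴴ * B * (Bᴴ * B)).trace = (Rst ^ 2).trace := by
    rw [sq, hRB, Matrix.mul_assoc, Matrix.trace_mul_comm]
    simp only [Matrix.mul_assoc]
  -- Cyclicity of the trace gathers the outer factors into `S = Bᴴ B`, and `S` and `Rst = B Bᴴ` have
  -- the same `Tr` and `Tr` of the square.
  have hpt : ∀ x : Fin n × Fin m → ℂ,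
      (((∑ a, ∑ b, ‖(B * partialProj x * Bᴴ) a b‖ ^ 2 : ℝ)) : ℂ) =
        (partialProj x * (Bᴴ * B) * (partialProj x * (Bᴴ * B))).trace := fun x => by
    have h := sum_mul_star_eq_trace (B * partialProj x * Bᴴ)
    have h2 : ∀ z : ℂ, ((‖z‖ ^ 2 : ℝ) : ℂ) = z * star z := fun z => by
      rw [Complex.star_def, Complex.mul_conj, Complex.normSq_eq_norm_sq]
    simp only [Complex.ofReal_sum, h2]
    rw [h, Matrix.conjTranspose_mul, Matrix.conjTranspose_mul, Matrix.conjTranspose_conjTranspose,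
      conjTranspose_partialProj, Matrix.mul_assoc B, Matrix.mul_assoc B, Matrix.trace_mul_comm B]
    simp only [Matrix.mul_assoc]
  apply Complex.ofReal_injective
  rw [← integral_complex_ofReal]
  refine (integral_cesLaw_kronecker hB hRB hA hRA
    (f := fun Z => ((∑ a, ∑ b, ‖Z a b‖ ^ 2 : ℝ) : ℂ)) ?_).trans ?_
  · refine Complex.measurable_ofReal.comp (Finset.measurable_sum _ fun a _ =>
      Finset.measurable_sum _ fun b _ => ?_)
    exact (measurable_sampleScatter Rst Rp a b).norm.pow_const 2
  · simp only [hpt]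
    rw [integral_trace_partialProj (unitarilyInvariant_whitenedLaw hBA hR hg)
      (whitenedLaw_singleton_zero hBA _ _ _), htr, htr2, ← ofReal_trace_re hRst.1,
      ← ofReal_trace_re (hRst.1.pow 2)]
    push_cast
    rfl

end ScatterMoments

/-! ### Second moments of sums of independent variables -/

section IndependentSums

variable {Ω : Type*} [MeasurableSpace Ω] {P : Measure Ω} [IsProbabilityMeasure P] {L : ℕ}

lemma ofReal_norm_sq (z : ℂ) : ((‖z‖ ^ 2 : ℝ) : ℂ) = z * star z := by
  rw [Complex.star_def, Complex.mul_conj, Complex.normSq_eq_norm_sq]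

/-- The second moment of an affine function of a sum of independent centred variables. -/
lemma integral_norm_sq_affine_sum {D : Fin L → Ω → ℂ} (hD : ∀ l, MemLp (D l) 2 P)
    (hD0 : ∀ l, ∫ ω, D l ω ∂P = 0) (hindep : Pairwise fun l k => D l ⟂ᵢ[P] D k) (α : ℝ) (β : ℂ) :
    ∫ ω, ‖α * ∑ l, D l ω + β‖ ^ 2 ∂P = α ^ 2 * ∑ l, ∫ ω, ‖D l ω‖ ^ 2 ∂P + ‖β‖ ^ 2 := by
  have hsD : ∀ l, MemLp (fun ω => star (D l ω)) 2 P := fun l => (hD l).star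
  have hi : ∀ l, Integrable (D l) P := fun l => (hD l).integrable (by norm_num)
  have hsi : ∀ l, Integrable (fun ω => star (D l ω)) P := fun l => (hsD l).integrable (by norm_num)
  have hii : ∀ l k, Integrable (fun ω => D l ω * star (D k ω)) P := fun l k =>
    (hD l).integrable_mul (hsD k)
  have hs0 : ∀ l, ∫ ω, star (D l ω) ∂P = 0 := fun l => by
    have : ∫ ω, star (D l ω) ∂P = star (∫ ω, D l ω ∂P) := integral_conj
    rw [this, hD0, star_zero]
  -- Off the diagonal the expectation factors by independence and the centred factor kills it.
  have hcross : ∀ l k, ∫ ω, D l ω * star (D k ω) ∂P =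
      if l = k then ((∫ ω, ‖D l ω‖ ^ 2 ∂P : ℝ) : ℂ) else 0 := by
    intro l k
    split_ifs with h
    · subst h
      rw [← integral_complex_ofReal]
      simp only [ofReal_norm_sq]
    · have hlk : D l ⟂ᵢ[P] (fun ω => star (D k ω)) :=
        (hindep h).comp measurable_id continuous_star.measurable
      rw [hlk.integral_fun_mul_eq_mul_integral (hi l).aestronglyMeasurable
        (hsi k).aestronglyMeasurable, hD0, zero_mul]
  apply Complex.ofReal_injective
  rw [← integral_complex_ofReal]
  have hexp : ∀ ω, ((‖α * ∑ l, D l ω + β‖ ^ 2 : ℝ) : ℂ) =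
      (α : ℂ) ^ 2 * ∑ l, ∑ k, D l ω * star (D k ω) +
        (α * star β * ∑ l, D l ω + (α * β * ∑ l, star (D l ω) + β * star β)) := fun ω => by
    rw [ofReal_norm_sq, ← Finset.sum_mul_sum]
    simp only [star_add, star_mul', star_sum, Complex.star_def, Complex.conj_ofReal]
    ring
  simp only [hexp]
  have i1 : Integrable (fun ω => (α : ℂ) ^ 2 * ∑ l, ∑ k, D l ω * star (D k ω)) P :=
    (integrable_finsetSum _ fun l _ => integrable_finsetSum _ fun k _ => hii l k).const_mul _
  have i2 : Integrable (fun ω => α * star β * ∑ l, D l ω) P :=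
    (integrable_finsetSum _ fun l _ => hi l).const_mul _
  have i3 : Integrable (fun ω => α * β * ∑ l, star (D l ω)) P :=
    (integrable_finsetSum _ fun l _ => hsi l).const_mul _
  have i4 : Integrable (fun _ : Ω => β * star β) P := integrable_const _
  have i34 : Integrable (fun ω => α * β * ∑ l, star (D l ω) + β * star β) P := i3.add i4
  have i234 : Integrable (fun ω => α * star β * ∑ l, D l ω +
      (α * β * ∑ l, star (D l ω) + β * star β)) P := i2.add i34
  rw [integral_add i1 i234, integral_add i2 i34, integral_add i3 i4,
    integral_const_mul, integral_const_mul, integral_const_mul,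
    integral_finsetSum _ fun l _ => integrable_finsetSum _ fun k _ => hii l k,
    integral_finsetSum _ fun l _ => hi l, integral_finsetSum _ fun l _ => hsi l]
  simp only [integral_finsetSum _ fun k _ => hii _ k, hcross, hD0, hs0, Finset.sum_ite_eq,
    Finset.mem_univ, if_true, Finset.sum_const_zero, mul_zero, zero_add]
  rw [integral_const, probReal_univ, one_smul, ← ofReal_norm_sq]
  push_cast
  ring

lemma integral_norm_sub_sq {X : Ω → ℂ} (hX : MemLp X 2 P) :
    ∫ ω, ‖X ω - ∫ ω', X ω' ∂P‖ ^ 2 ∂P = ∫ ω, ‖X ω‖ ^ 2 ∂P - ‖∫ ω, X ω ∂P‖ ^ 2 := by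
  set M := ∫ ω, X ω ∂P with hM
  have hi : Integrable X P := hX.integrable (by norm_num)
  have hsi : Integrable (fun ω => star (X ω)) P := hX.star.integrable (by norm_num)
  have hii : Integrable (fun ω => X ω * star (X ω)) P := hX.integrable_mul hX.star
  have hsM : ∫ ω, star (X ω) ∂P = star M := integral_conj
  apply Complex.ofReal_injective
  rw [Complex.ofReal_sub, ← integral_complex_ofReal, ← integral_complex_ofReal]
  simp only [ofReal_norm_sq]
  have hexp : ∀ ω, (X ω - M) * star (X ω - M) =
      X ω * star (X ω) - (star M * X ω + (M * star (X ω) - M * star M)) := fun ω => by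
    rw [star_sub]; ring
  simp only [hexp]
  have i4 : Integrable (fun _ : Ω => M * star M) P := integrable_const _
  have i34 : Integrable (fun ω => M * star (X ω) - M * star M) P := (hsi.const_mul _).sub i4
  have i234 : Integrable (fun ω => star M * X ω + (M * star (X ω) - M * star M)) P :=
    (hi.const_mul _).add i34
  rw [integral_sub hii i234, integral_add (hi.const_mul _) i34, integral_sub (hsi.const_mul _) i4,
    integral_const_mul, integral_const_mul, hsM, ← hM, integral_const, probReal_univ, one_smul]
  ring

end IndependentSums

/-! ### Minimizing the quadratic in `ρ` -/

section Minimizer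

lemma forall_le_iff_eq_div {V M : ℝ} (h : 0 < V + M) (ρ : ℝ) :
    (∀ ρ', (1 - ρ) ^ 2 * V + ρ ^ 2 * M ≤ (1 - ρ') ^ 2 * V + ρ' ^ 2 * M) ↔ ρ = V / (V + M) := by
  have key : ∀ r, (1 - r) ^ 2 * V + r ^ 2 * M =
      (V + M) * (r - V / (V + M)) ^ 2 + V * M / (V + M) := fun r => by
    field_simp
    ring
  simp only [key]
  constructor
  · intro hρ
    have h1 := hρ (V / (V + M))
    have h2 : (V + M) * (ρ - V / (V + M)) ^ 2 ≤ 0 := by nlinarith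
    have h3 : (ρ - V / (V + M)) ^ 2 ≤ 0 := by
      by_contra hc
      push Not at hc
      nlinarith [mul_pos h hc]
    have h4 := pow_eq_zero_iff (two_ne_zero) |>.1 (le_antisymm h3 (sq_nonneg _))
    linarith
  · rintro rfl ρ'
    have := mul_nonneg h.le (sq_nonneg (ρ' - V / (V + M)))
    simpa using this

end Minimizer

/-! ### The Frobenius error entry by entry -/

section Error

variable {n : ℕ}

lemma sqError_eq_sum (R C : Matrix (Fin n) (Fin n) ℂ) (ρ : ℝ) :
    sqError R C ρ = ∑ a, ∑ b,
      ‖((1 - ρ : ℝ) : ℂ) * C a b + ρ * (1 : Matrix (Fin n) (Fin n) ℂ) a b - R a b‖ ^ 2 := by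
  open scoped Matrix.Norms.Frobenius in
  rw [sqError, Matrix.frobenius_norm_def, ← Real.sqrt_eq_rpow, Real.sq_sqrt (by positivity)]
  simp [Complex.real_smul]

lemma sum_norm_one_sub_sq {R : Matrix (Fin n) (Fin n) ℂ} (hR : R.IsHermitian) :
    ∑ a, ∑ b, ‖(1 : Matrix (Fin n) (Fin n) ℂ) a b - R a b‖ ^ 2 =
      n - 2 * R.trace.re + (R ^ 2).trace.re := by
  have h := sum_norm_sq_eq_trace_sq (Matrix.isHermitian_one.sub hR)
  simp only [Matrix.sub_apply] at h
  rw [h]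
  have : (1 - R) ^ 2 = 1 - (R + R) + R ^ 2 := by noncomm_ring
  rw [this]
  simp [Matrix.trace_add, Matrix.trace_sub, two_mul]

end Error

/-! ### The error of the shrunk `C_st` -/

section Shrinkage

variable {Ω : Type*} [MeasurableSpace Ω] {P : Measure Ω} [IsProbabilityMeasure P] {L n m : ℕ}
  {Rst : Matrix (Fin n) (Fin n) ℂ} {Rp : Matrix (Fin m) (Fin m) ℂ} {c : ℝ} {g : ℝ → ℝ}
  {y : Fin L → Ω → (Fin n × Fin m → ℂ)}

lemma Cst_apply (Rst : Matrix (Fin n) (Fin n) ℂ) (Rp : Matrix (Fin m) (Fin m) ℂ)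
    (z : Fin L → Fin n × Fin m → ℂ) (hm : 0 < m) (a b : Fin n) :
    Cst Rst Rp z a b = ((n / L : ℝ) : ℂ) * ∑ l, sampleScatter Rst Rp (z l) a b := by
  have hm' : (m : ℝ) ≠ 0 := by exact_mod_cast hm.ne'
  have : ((n * m : ℕ) : ℝ) / ((L : ℝ) * m) = n / L := by
    push_cast
    exact mul_div_mul_right _ _ hm'
  rw [Cst, this, Matrix.smul_apply, Matrix.sum_apply, Complex.real_smul]
  rfl

lemma memLp_sampleScatter (hRst : Rst.PosDef) (hRp : Rp.PosDef) {X : Ω → (Fin n × Fin m → ℂ)}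
    (hX : AEMeasurable X P) (a b : Fin n) :
    MemLp (fun ω => sampleScatter Rst Rp (X ω) a b) 2 P := by
  obtain ⟨K, hK⟩ := exists_norm_sampleScatter_le hRst hRp a b
  exact .of_bound ((measurable_sampleScatter Rst Rp a b).comp_aemeasurable hX).aestronglyMeasurable
    K (.of_forall fun ω => hK _)

/-- The deviation of one entry of one sample contribution from its mean. -/
def centredEntry (Rst : Matrix (Fin n) (Fin n) ℂ) (Rp : Matrix (Fin m) (Fin m) ℂ)
    (a b : Fin n) (v : Fin n × Fin m → ℂ) : ℂ :=
  sampleScatter Rst Rp v a b - (1 / n : ℂ) * Rst a b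

/-- The split `(1 - ρ) C + ρ I - R = (1 - ρ)(C - R) + ρ (I - R)`, where `C - R` is `n / L` times the
sum of the centred contributions. -/
lemma sqError_Cst_eq_sum (hL : 0 < L) (hn : 0 < n) (hm : 0 < m) (z : Fin L → Fin n × Fin m → ℂ)
    (ρ : ℝ) :
    sqError Rst (Cst Rst Rp z) ρ = ∑ a, ∑ b, ‖(((1 - ρ) * (n / L) : ℝ) : ℂ) *
      ∑ l, centredEntry Rst Rp a b (z l) +
        ρ * ((1 : Matrix (Fin n) (Fin n) ℂ) a b - Rst a b)‖ ^ 2 := by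
  rw [sqError_eq_sum]
  refine Finset.sum_congr rfl fun a _ => Finset.sum_congr rfl fun b _ => ?_
  have hL' : (L : ℂ) ≠ 0 := by exact_mod_cast hL.ne'
  have hn' : (n : ℂ) ≠ 0 := by exact_mod_cast hn.ne'
  rw [Cst_apply _ _ _ hm]
  simp only [centredEntry, Finset.sum_sub_distrib, Finset.sum_const, Finset.card_univ,
    Fintype.card_fin, nsmul_eq_mul]
  congr 2
  push_cast
  field_simp
  ring

lemma memLp_centredEntry (hRst : Rst.PosDef) (hRp : Rp.PosDef) {X : Ω → (Fin n × Fin m → ℂ)}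
    (hX : AEMeasurable X P) (a b : Fin n) :
    MemLp (fun ω => centredEntry Rst Rp a b (X ω)) 2 P :=
  (memLp_sampleScatter hRst hRp hX a b).sub (memLp_const _)

lemma integrable_sqError_entry (hRst : Rst.PosDef) (hRp : Rp.PosDef)
    (hy : ∀ l, AEMeasurable (y l) P) (α : ℝ) (β : ℂ) (a b : Fin n) :
    Integrable (fun ω => ‖(α : ℂ) * ∑ l, centredEntry Rst Rp a b (y l ω) + β‖ ^ 2) P := by
  have h : MemLp (fun ω => (α : ℂ) * ∑ l, centredEntry Rst Rp a b (y l ω) + β) 2 P :=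
    ((memLp_finsetSum _ fun l _ => memLp_centredEntry hRst hRp (hy l) a b).const_mul _).add
      (memLp_const _)
  exact h.integrable_norm_pow (by norm_num)

lemma integrable_sqError_Cst (hL : 0 < L) (hn : 0 < n) (hm : 0 < m) (hRst : Rst.PosDef)
    (hRp : Rp.PosDef) (hy : ∀ l, AEMeasurable (y l) P) (ρ : ℝ) :
    Integrable (fun ω => sqError Rst (Cst Rst Rp (fun l => y l ω)) ρ) P := by
  simp only [sqError_Cst_eq_sum hL hn hm]
  exact integrable_finsetSum _ fun a _ => integrable_finsetSum _ fun b _ =>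
    integrable_sqError_entry hRst hRp hy _ _ a b

/-- The mean squared error of the unshrunk estimate `C_st`. -/
def estVariance (L m : ℕ) (R : Matrix (Fin n) (Fin n) ℂ) : ℝ :=
  (n * R.trace.re ^ 2 - (R ^ 2).trace.re) / (L * (n * m + 1))

/-- The squared error of the shrinkage target `I`. -/
def targetError (R : Matrix (Fin n) (Fin n) ℂ) : ℝ :=
  n - 2 * R.trace.re + (R ^ 2).trace.re

lemma integral_sqError_Cst (hL : 0 < L) (hn : 0 < n) (hm : 0 < m) (hRst : Rst.PosDef)
    (hRp : Rp.PosDef) (hg : Measurable g)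
    (hlaw : ∀ l, HasLaw (y l) (cesLaw (Rst ⊗ₖ Rp) c g) P) (hindep : iIndepFun y P) (ρ : ℝ) :
    ∫ ω, sqError Rst (Cst Rst Rp (fun l => y l ω)) ρ ∂P =
      (1 - ρ) ^ 2 * estVariance L m Rst + ρ ^ 2 * targetError Rst := by
  have hy : ∀ l, AEMeasurable (y l) P := fun l => (hlaw l).aemeasurable
  have hprob : IsProbabilityMeasure (cesLaw (Rst ⊗ₖ Rp) c g) :=
    (hlaw ⟨0, hL⟩).isProbabilityMeasure_iff.1 inferInstance
  have hmeas := measurable_sampleScatter Rst Rp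
  have hmean : ∀ l a b, ∫ ω, sampleScatter Rst Rp (y l ω) a b ∂P = (1 / n : ℂ) * Rst a b := by
    intro l a b
    rw [← integral_sampleScatter hn hm hRst hRp hg a b (c := c)]
    exact (hlaw l).integral_comp (hmeas a b).aestronglyMeasurable
  have hterm : ∀ a b, ∫ ω, ‖(((1 - ρ) * (n / L) : ℝ) : ℂ) *
      ∑ l, centredEntry Rst Rp a b (y l ω) +
        ρ * ((1 : Matrix (Fin n) (Fin n) ℂ) a b - Rst a b)‖ ^ 2 ∂P =
      ((1 - ρ) * (n / L)) ^ 2 * (L * (∫ v, ‖sampleScatter Rst Rp v a b‖ ^ 2 ∂(cesLaw (Rst ⊗ₖ Rp) c g)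
        - 1 / n ^ 2 * ‖Rst a b‖ ^ 2)) + ρ ^ 2 * ‖(1 : Matrix (Fin n) (Fin n) ℂ) a b - Rst a b‖ ^ 2 := by
    intro a b
    have hm1 : Measurable (centredEntry Rst Rp a b) := (hmeas a b).sub_const _
    rw [integral_norm_sq_affine_sum (D := fun l ω => centredEntry Rst Rp a b (y l ω))
      (fun l => memLp_centredEntry hRst hRp (hy l) a b)]
    · have hvar : ∀ l, ∫ ω, ‖centredEntry Rst Rp a b (y l ω)‖ ^ 2 ∂P =
          ∫ v, ‖sampleScatter Rst Rp v a b‖ ^ 2 ∂(cesLaw (Rst ⊗ₖ Rp) c g)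
            - 1 / n ^ 2 * ‖Rst a b‖ ^ 2 := by
        intro l
        have h := integral_norm_sub_sq (memLp_sampleScatter hRst hRp (hy l) a b)
        rw [hmean] at h
        have h2 : ∫ ω, ‖sampleScatter Rst Rp (y l ω) a b‖ ^ 2 ∂P =
            ∫ v, ‖sampleScatter Rst Rp v a b‖ ^ 2 ∂(cesLaw (Rst ⊗ₖ Rp) c g) :=
          (hlaw l).integral_comp (f := fun v => ‖sampleScatter Rst Rp v a b‖ ^ 2)
            ((hmeas a b).norm.pow_const 2).aestronglyMeasurable
        rw [h2] at h
        simp only [centredEntry]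
        rw [h, norm_mul, mul_pow]
        simp
      simp only [hvar, Finset.sum_const, Finset.card_univ, Fintype.card_fin, nsmul_eq_mul]
      rw [norm_mul, Complex.norm_real, Real.norm_eq_abs, mul_pow |ρ|, sq_abs]
    · intro l
      simp only [centredEntry]
      rw [integral_sub ((memLp_sampleScatter hRst hRp (hy l) a b).integrable (by norm_num))
        (integrable_const _), hmean, integral_const, probReal_univ, one_smul, sub_self]
    · intro l k hlk
      exact (hindep.indepFun hlk).comp hm1 hm1
  have hentry : ∀ a b, Integrable (fun v => ‖sampleScatter Rst Rp v a b‖ ^ 2)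
      (cesLaw (Rst ⊗ₖ Rp) c g) := fun a b =>
    (memLp_sampleScatter hRst hRp aemeasurable_id a b).integrable_norm_pow (by norm_num)
  have hsecond := integral_sum_norm_sq_sampleScatter (c := c) hn hm hRst hRp hg
  rw [integral_finsetSum _ fun a _ => integrable_finsetSum _ fun b _ => hentry a b] at hsecond
  simp only [integral_finsetSum _ fun b _ => hentry _ b] at hsecond
  simp only [sqError_Cst_eq_sum hL hn hm]
  rw [integral_finsetSum _ fun a _ => integrable_finsetSum _ fun b _ =>
    integrable_sqError_entry hRst hRp hy _ _ a b]
  simp only [integral_finsetSum _ fun b _ => integrable_sqError_entry hRst hRp hy _ _ _ b, hterm,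
    Finset.sum_add_distrib, ← Finset.mul_sum, Finset.sum_sub_distrib]
  rw [hsecond, sum_norm_one_sub_sq hRst.1, sum_norm_sq_eq_trace_sq hRst.1, estVariance, targetError]
  have hL' : (L : ℝ) ≠ 0 := by exact_mod_cast hL.ne'
  have hn' : (n : ℝ) ≠ 0 := by exact_mod_cast hn.ne'
  have hm' : (m : ℝ) ≠ 0 := by exact_mod_cast hm.ne'
  have hN : (n * m + 1 : ℝ) ≠ 0 := by positivity
  -- The `ρ²` parts agree. The rest is `(n² / L) ((m² Tr R² + m Tr² R) / (nm (nm + 1)) - Tr R² / n²)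
  -- = estVariance`.
  congr 1
  field_simp
  ring

lemma targetError_nonneg {R : Matrix (Fin n) (Fin n) ℂ} (hR : R.IsHermitian) :
    0 ≤ targetError R := by
  rw [targetError, ← sum_norm_one_sub_sq hR]
  positivity

lemma targetError_pos {R : Matrix (Fin n) (Fin n) ℂ} (hR : R.IsHermitian) (h1 : R ≠ 1) :
    0 < targetError R := by
  refine (targetError_nonneg hR).lt_of_ne' fun h => h1 ?_
  rw [targetError, ← sum_norm_one_sub_sq hR,
    Finset.sum_eq_zero_iff_of_nonneg fun _ _ => by positivity] at h
  ext a b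
  have ha := h a (Finset.mem_univ a)
  rw [Finset.sum_eq_zero_iff_of_nonneg fun _ _ => by positivity] at ha
  have hab := ha b (Finset.mem_univ b)
  rw [pow_eq_zero_iff two_ne_zero, norm_eq_zero, sub_eq_zero] at hab
  exact hab.symm

lemma koasNum_eq (hL : 0 < L) (hn : 0 < n) (m : ℕ) (R : Matrix (Fin n) (Fin n) ℂ) :
    koasNum R = L * (n * m + 1) / n * estVariance L m R := by
  have hL' : (L : ℝ) ≠ 0 := by exact_mod_cast hL.ne'
  have hn' : (n : ℝ) ≠ 0 := by exact_mod_cast hn.ne'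
  have hN : (n * m + 1 : ℝ) ≠ 0 := by positivity
  rw [koasNum, estVariance]
  field_simp

lemma koasDen_eq (hL : 0 < L) (hn : 0 < n) (m : ℕ) (R : Matrix (Fin n) (Fin n) ℂ) :
    koasDen L m R = L * (n * m + 1) / n * (estVariance L m R + targetError R) := by
  have hL' : (L : ℝ) ≠ 0 := by exact_mod_cast hL.ne'
  have hn' : (n : ℝ) ≠ 0 := by exact_mod_cast hn.ne'
  have hN : (n * m + 1 : ℝ) ≠ 0 := by positivity
  rw [koasDen, estVariance, targetError]
  push_cast
  field_simp
  ring

lemma estVariance_one_pos (hL : 0 < L) (hn : 0 < n) (h1 : n ≠ 1) (m : ℕ) :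
    0 < estVariance L m (1 : Matrix (Fin n) (Fin n) ℂ) := by
  have hL' : (0 : ℝ) < L := by exact_mod_cast hL
  have hn' : (2 : ℝ) ≤ n := by exact_mod_cast (by omega : 2 ≤ n)
  rw [estVariance]
  have : (0 : ℝ) < n * n ^ 2 - n := by nlinarith
  simp only [one_pow, Matrix.trace_one, Fintype.card_fin, Complex.natCast_re]
  positivity

/-- The minimizer of the mean squared error of the shrunk estimate of the first factor. -/
lemma shrinkage_Cst (hL : 0 < L) (hn : 0 < n) (hm : 0 < m) (hRst : Rst.PosDef)
    (hRp : Rp.PosDef) (hg : Measurable g)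
    (hlaw : ∀ l, HasLaw (y l) (cesLaw (Rst ⊗ₖ Rp) c g) P) (hindep : iIndepFun y P)
    (hne : n ≠ 1 ∨ Rst ≠ 1) :
    koasDen L m Rst ≠ 0 ∧ ∀ ρ : ℝ,
      (∀ ρ' : ℝ, ∫ ω, sqError Rst (Cst Rst Rp (fun l => y l ω)) ρ ∂P ≤
        ∫ ω, sqError Rst (Cst Rst Rp (fun l => y l ω)) ρ' ∂P) ↔
        ρ = koasNum Rst / koasDen L m Rst := by
  have hint := integral_sqError_Cst hL hn hm hRst hRp hg hlaw hindep
  -- At `ρ = 0` the error formula exhibits it as the integral of a square, so no trace inequality is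
  -- needed.
  have hV : 0 ≤ estVariance L m Rst := by
    have h0 := hint 0
    simp only [sub_zero, one_pow, one_mul, ne_eq, OfNat.ofNat_ne_zero, not_false_eq_true, zero_pow,
      zero_mul, add_zero] at h0
    rw [← h0]
    exact integral_nonneg fun ω => by simp only [sqError]; positivity
  have hpos : 0 < estVariance L m Rst + targetError Rst := by
    -- For `Rst = 1` the target error is zero, and `n ≥ 2` makes `n³ - n` positive; otherwise the
    -- target error is positive.
    by_cases h1 : Rst = 1
    · have h2 := estVariance_one_pos hL hn (hne.resolve_right (not_not.2 h1)) m
      rw [← h1] at h2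
      exact add_pos_of_pos_of_nonneg h2 (targetError_nonneg hRst.1)
    · exact add_pos_of_nonneg_of_pos hV (targetError_pos hRst.1 h1)
  have hL' : (0 : ℝ) < L := by exact_mod_cast hL
  have hn' : (0 : ℝ) < n := by exact_mod_cast hn
  have hk : (0 : ℝ) < L * (n * m + 1) / n := by positivity
  rw [koasNum_eq hL hn m, koasDen_eq hL hn m, mul_div_mul_left _ _ hk.ne']
  refine ⟨(mul_pos hk hpos).ne', fun ρ => ?_⟩
  simp only [hint]
  exact forall_le_iff_eq_div hpos ρ

end Shrinkage

/-! ### Exchanging the two Kronecker factors -/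

section Swap

variable {n m : ℕ}

lemma quadForm_swap (Rst : Matrix (Fin n) (Fin n) ℂ) (Rp : Matrix (Fin m) (Fin m) ℂ)
    (v : Fin n × Fin m → ℂ) :
    quadForm (Rp ⊗ₖ Rst) (v ∘ Prod.swap) = quadForm (Rst ⊗ₖ Rp) v := by
  rw [quadForm, quadForm, Matrix.inv_kronecker, Matrix.inv_kronecker]
  congr 1
  simp only [dotProduct, Matrix.mulVec, Pi.star_apply, Function.comp_apply]
  refine Fintype.sum_equiv (Equiv.prodComm _ _) _ _ fun i => ?_
  congr 1
  refine Fintype.sum_equiv (Equiv.prodComm _ _) _ _ fun j => ?_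
  simp only [Matrix.kroneckerMap_apply, Equiv.prodComm_apply, Prod.fst_swap, Prod.snd_swap]
  ring

/-- Swapping the index pair transposes the reshaped matrix, and the outer transpose in `Cst` then
produces `Y (Rst⁻¹)ᵀ Yᴴ`. -/
lemma Cp_eq_Cst_swap {L : ℕ} (Rst : Matrix (Fin n) (Fin n) ℂ) (Rp : Matrix (Fin m) (Fin m) ℂ)
    (y : Fin L → Fin n × Fin m → ℂ) :
    Cp Rst Rp y = Cst Rp Rst fun l => y l ∘ Prod.swap := by
  have h : ∀ v : Fin n × Fin m → ℂ, unvec (v ∘ Prod.swap) = (unvec v)ᵀ := fun _ => rfl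
  simp only [Cp, Cst, quadForm_swap, h, Matrix.transpose_mul, Matrix.transpose_transpose,
    Matrix.mul_assoc, mul_comm m n]
  rfl

lemma det_kronecker_swap (Rst : Matrix (Fin n) (Fin n) ℂ) (Rp : Matrix (Fin m) (Fin m) ℂ) :
    (Rp ⊗ₖ Rst).det = (Rst ⊗ₖ Rp).det := by
  rw [Matrix.det_kronecker, Matrix.det_kronecker, mul_comm]

lemma measurable_comp_swap :
    Measurable fun v : Fin n × Fin m → ℂ => (v ∘ Prod.swap : Fin m × Fin n → ℂ) :=
  measurable_pi_lambda _ fun i => measurable_pi_apply i.swap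

lemma map_volume_comp_swap : (volume : Measure (Fin n × Fin m → ℂ)).map
    (fun v => (v ∘ Prod.swap : Fin m × Fin n → ℂ)) = volume :=
  (volume_measurePreserving_piCongrLeft (fun _ : Fin m × Fin n => ℂ)
    (Equiv.prodComm (Fin n) (Fin m))).map_eq

lemma map_cesLaw_swap (Rst : Matrix (Fin n) (Fin n) ℂ) (Rp : Matrix (Fin m) (Fin m) ℂ) (c : ℝ)
    {g : ℝ → ℝ} (hg : Measurable g) :
    (cesLaw (Rst ⊗ₖ Rp) c g).map (fun v => (v ∘ Prod.swap : Fin m × Fin n → ℂ)) =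
      cesLaw (Rp ⊗ₖ Rst) c g := by
  ext s hs
  rw [Measure.map_apply measurable_comp_swap hs, cesLaw, cesLaw,
    withDensity_apply _ (measurable_comp_swap hs), withDensity_apply _ hs,
    ← map_volume_comp_swap (n := n) (m := m), setLIntegral_map hs (by fun_prop) measurable_comp_swap]
  simp only [quadForm_swap, det_kronecker_swap]

lemma hasLaw_comp_swap {Ω : Type*} [MeasurableSpace Ω] {P : Measure Ω}
    {Rst : Matrix (Fin n) (Fin n) ℂ} {Rp : Matrix (Fin m) (Fin m) ℂ} {c : ℝ}
    {g : ℝ → ℝ} (hg : Measurable g) {X : Ω → (Fin n × Fin m → ℂ)}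
    (hX : HasLaw X (cesLaw (Rst ⊗ₖ Rp) c g) P) :
    HasLaw (fun ω => X ω ∘ Prod.swap) (cesLaw (Rp ⊗ₖ Rst) c g) P :=
  HasLaw.fun_comp ⟨measurable_comp_swap.aemeasurable, map_cesLaw_swap Rst Rp c hg⟩ hX

end Swap

end KroneckerShrinkage

end

/-! ### Both shrinkage coefficients -/

theorem proposition3 {Ω : Type*} [MeasurableSpace Ω] (P : Measure Ω) [IsProbabilityMeasure P]
    (L Nst Np : ℕ) (hL : 0 < L) (hNst : 0 < Nst) (hNp : 0 < Np)
    (Rst : Matrix (Fin Nst) (Fin Nst) ℂ) (Rp : Matrix (Fin Np) (Fin Np) ℂ)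
    (hRst : Rst.PosDef) (hRp : Rp.PosDef)
    (c : ℝ) (hc : 0 < c) (g : ℝ → ℝ) (hg : Measurable g) (hg0 : ∀ t, 0 ≤ t → 0 ≤ g t)
    (y : Fin L → Ω → (Fin Nst × Fin Np → ℂ))
    (hlaw : ∀ l, HasLaw (y l) (KroneckerShrinkage.cesLaw (Rst ⊗ₖ Rp) c g) P)
    (hindep : iIndepFun y P) :
    ((∀ ρ : ℝ, Integrable
          (fun ω => KroneckerShrinkage.sqError Rst
            (KroneckerShrinkage.Cst Rst Rp (fun l => y l ω)) ρ) P) ∧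
      (Nst ≠ 1 ∨ Rst ≠ 1 →
        KroneckerShrinkage.koasDen L Np Rst ≠ 0 ∧
        ∀ ρ : ℝ,
          (∀ ρ' : ℝ,
            ∫ ω, KroneckerShrinkage.sqError Rst
                (KroneckerShrinkage.Cst Rst Rp (fun l => y l ω)) ρ ∂P ≤
              ∫ ω, KroneckerShrinkage.sqError Rst
                (KroneckerShrinkage.Cst Rst Rp (fun l => y l ω)) ρ' ∂P) ↔
            ρ = KroneckerShrinkage.koasNum Rst / KroneckerShrinkage.koasDen L Np Rst)) ∧
    ((∀ ρ : ℝ, Integrable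
          (fun ω => KroneckerShrinkage.sqError Rp
            (KroneckerShrinkage.Cp Rst Rp (fun l => y l ω)) ρ) P) ∧
      (Np ≠ 1 ∨ Rp ≠ 1 →
        KroneckerShrinkage.koasDen L Nst Rp ≠ 0 ∧
        ∀ ρ : ℝ,
          (∀ ρ' : ℝ,
            ∫ ω, KroneckerShrinkage.sqError Rp
                (KroneckerShrinkage.Cp Rst Rp (fun l => y l ω)) ρ ∂P ≤
              ∫ ω, KroneckerShrinkage.sqError Rp
                (KroneckerShrinkage.Cp Rst Rp (fun l => y l ω)) ρ' ∂P) ↔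
            ρ = KroneckerShrinkage.koasNum Rp / KroneckerShrinkage.koasDen L Nst Rp)) := by
  have hy : ∀ l, AEMeasurable (y l) P := fun l => (hlaw l).aemeasurable
  have hlaw' := fun l => KroneckerShrinkage.hasLaw_comp_swap hg (hlaw l)
  have hindep' : iIndepFun (fun l ω => (y l ω ∘ Prod.swap : Fin Np × Fin Nst → ℂ)) P :=
    hindep.comp _ fun _ => KroneckerShrinkage.measurable_comp_swap
  simp only [KroneckerShrinkage.Cp_eq_Cst_swap]
  exact ⟨⟨KroneckerShrinkage.integrable_sqError_Cst hL hNst hNp hRst hRp hy,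
      KroneckerShrinkage.shrinkage_Cst hL hNst hNp hRst hRp hg hlaw hindep⟩,
    KroneckerShrinkage.integrable_sqError_Cst hL hNp hNst hRp hRst fun l => (hlaw' l).aemeasurable,
    KroneckerShrinkage.shrinkage_Cst hL hNp hNst hRp hRst hg hlaw' hindep'⟩
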